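/- Let $K$ be a field. A coalgebra over $K$ is a $K$-vector space $C$ with a coassociative comultiplication $\Delta_C\colon C\to C\otimes_K C$ and a counit $\varepsilon_C\colon C\to K$; a right $C$-comodule is a $K$-vector space $M$ with a coassociative and counital linear coaction $\rho_M\colon M\to M\otimes_K C$, and $\mathcal M^C$ denotes the category of right $C$-comodules and $K$-linear maps commuting with the coactions. For a morphism of $K$-coalgebras $\lambda\colon C\to D$ let $U\colon\mathcal M^C\to\mathcal M^D$ be the corestriction functor, which sends $(M,\rho_M)$ to $(M,(\mathrm{id}_M\otimes\lambda)\circ\rho_M)$ and every morphism to itself. Call $\lambda$ a Frobenius extension of coalgebras if $U$ is a Frobenius functor, i.e. $U$ has both a left adjoint and a right adjoint, and these are naturally isomorphic. Theorem 3.3. Let $C,D$ be coalgebras over a field $K$ and let $\lambda\colon C\to D$ be a Frobenius extension of coalgebras. Then either $\dim_K C\le\dim_K D$ (as cardinal numbers), or $C$ and $D$ are both finite dimensional over $K$. -/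

import Mathlib

open CategoryTheory
open scoped TensorProduct

universe v u

namespace FrobeniusExtension

variable (K : Type u) [Field K]
variable (C : Type v) [AddCommGroup C] [Module K C] [Coalgebra K C]

/-- A right `C`-comodule over the field `K`: a `K`-vector space `M` with a `K`-linear coaction
`M → M ⊗ C` that is coassociative and counital. -/
structure RightComod where
  /-- The underlying vector space. -/
  carrier : Type v
  [addCommGroup : AddCommGroup carrier]
  [module : Module K carrier]
  /-- The coaction `ρ : M → M ⊗ C`. -/
  coact : carrier →ₗ[K] carrier ⊗[K] C
  /-- `(ρ ⊗ C) ∘ ρ = (M ⊗ Δ) ∘ ρ`, up to the associativity isomorphism. -/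
  coassoc : (TensorProduct.assoc K carrier C C).toLinearMap ∘ₗ coact.rTensor C ∘ₗ coact =
    (Coalgebra.comul (R := K) (A := C)).lTensor carrier ∘ₗ coact
  /-- `(M ⊗ ε) ∘ ρ = id`, up to the isomorphism `M ⊗ K ≃ M`. -/
  counit_coact : (TensorProduct.rid K carrier).toLinearMap ∘ₗ
    (Coalgebra.counit (R := K) (A := C)).lTensor carrier ∘ₗ coact = LinearMap.id

namespace RightComod

attribute [instance] addCommGroup module

variable {K C}

/-- Morphisms of right `C`-comodules: `K`-linear maps compatible with the coactions. -/
@[ext]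
structure Hom (M N : RightComod K C) where
  /-- The underlying linear map. -/
  toLinearMap : M.carrier →ₗ[K] N.carrier
  /-- `ρ_N ∘ f = (f ⊗ C) ∘ ρ_M`. -/
  comm : N.coact ∘ₗ toLinearMap = toLinearMap.rTensor C ∘ₗ M.coact

/-- The category of right `C`-comodules. -/
instance : Category (RightComod K C) where
  Hom := Hom
  id M := ⟨LinearMap.id, by simp⟩
  comp f g := ⟨g.toLinearMap ∘ₗ f.toLinearMap, by
    rw [← LinearMap.comp_assoc, g.comm, LinearMap.comp_assoc, f.comm, ← LinearMap.comp_assoc,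
      ← LinearMap.rTensor_comp]⟩

@[simp]
theorem id_toLinearMap (M : RightComod K C) : Hom.toLinearMap (𝟙 M) = LinearMap.id := rfl

@[simp]
theorem comp_toLinearMap {M N P : RightComod K C} (f : M ⟶ N) (g : N ⟶ P) :
    Hom.toLinearMap (f ≫ g) = Hom.toLinearMap g ∘ₗ Hom.toLinearMap f := rfl

variable {D : Type v} [AddCommGroup D] [Module K D] [Coalgebra K D]

/-- A right `C`-comodule viewed as a right `D`-comodule along a coalgebra morphism
`l : C → D`, with coaction `m ↦ m₀ ⊗ l(m₁)`. -/
def corestrictObj (l : C →ₗc[K] D) (M : RightComod K C) : RightComod K D where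
  carrier := M.carrier
  coact := l.toLinearMap.lTensor M.carrier ∘ₗ M.coact
  coassoc := by
    have h1 : (TensorProduct.assoc K M.carrier D D).toLinearMap ∘ₗ
        (l.toLinearMap.lTensor M.carrier ∘ₗ M.coact).rTensor D ∘ₗ l.toLinearMap.lTensor M.carrier =
        (TensorProduct.map l.toLinearMap l.toLinearMap).lTensor M.carrier ∘ₗ
          (TensorProduct.assoc K M.carrier C C).toLinearMap ∘ₗ M.coact.rTensor C := by
      ext m c
      simp only [TensorProduct.AlgebraTensorModule.curry_apply, TensorProduct.curry_apply,
        LinearMap.coe_restrictScalars, LinearMap.comp_apply, LinearMap.lTensor_tmul,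
        LinearMap.rTensor_tmul]
      induction M.coact m with
      | zero => simp
      | tmul x y => simp
      | add x y hx hy => simp only [map_add, TensorProduct.add_tmul] at hx hy ⊢; rw [hx, hy]
    calc _ = ((TensorProduct.assoc K M.carrier D D).toLinearMap ∘ₗ
        (l.toLinearMap.lTensor M.carrier ∘ₗ M.coact).rTensor D ∘ₗ
          l.toLinearMap.lTensor M.carrier) ∘ₗ M.coact := rfl
      _ = (TensorProduct.map l.toLinearMap l.toLinearMap).lTensor M.carrier ∘ₗ
          ((TensorProduct.assoc K M.carrier C C).toLinearMap ∘ₗ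
            M.coact.rTensor C ∘ₗ M.coact) := by rw [h1]; rfl
      _ = _ := by
        rw [M.coassoc, ← LinearMap.comp_assoc, ← LinearMap.lTensor_comp, l.map_comp_comul,
          LinearMap.lTensor_comp, LinearMap.comp_assoc]
  counit_coact := by
    rw [← LinearMap.comp_assoc M.coact, ← LinearMap.lTensor_comp, l.counit_comp]
    exact M.counit_coact

/-- The corestriction functor `U : M^C ⥤ M^D` of a coalgebra morphism `l : C → D`. It is the
identity on underlying vector spaces and on underlying linear maps. -/
def corestrict (l : C →ₗc[K] D) : RightComod K C ⥤ RightComod K D where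
  obj M := corestrictObj l M
  map {M N} (f : Hom M N) := Hom.mk f.toLinearMap <| by
    change (l.toLinearMap.lTensor N.carrier ∘ₗ N.coact) ∘ₗ Hom.toLinearMap f =
      (Hom.toLinearMap f).rTensor D ∘ₗ l.toLinearMap.lTensor M.carrier ∘ₗ M.coact
    rw [LinearMap.comp_assoc, Hom.comm, ← LinearMap.comp_assoc, ← LinearMap.comp_assoc,
      LinearMap.lTensor_comp_rTensor, LinearMap.rTensor_comp_lTensor]

end RightComod

/-- A functor `U` is a Frobenius functor if it has a left adjoint and a right adjoint and these
are naturally isomorphic. -/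
def IsFrobeniusFunctor {A : Type*} [Category* A] {B : Type*} [Category* B] (U : A ⥤ B) : Prop :=
  ∃ L R : B ⥤ A, Nonempty (L ⊣ U) ∧ Nonempty (U ⊣ R) ∧ Nonempty (L ≅ R)

variable {K C}
variable {D : Type v} [AddCommGroup D] [Module K D] [Coalgebra K D]

/-- A coalgebra morphism `l : C → D` is a (right) Frobenius extension of coalgebras if its
corestriction functor from right `C`-comodules to right `D`-comodules is a Frobenius functor. -/
def IsFrobeniusExtension (l : C →ₗc[K] D) : Prop :=
  IsFrobeniusFunctor (RightComod.corestrict l)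

end FrobeniusExtension

/-! Let `L ⊣ U ⊣ R` with `L ≅ R`, so that `L` is adjoint to `U` on both sides; evaluate it at the
regular comodule `D`. As a right adjoint, `L D` is large: the adjunct `C → L D` of `λ` is injective
because the counit of `C` factors through it (`injective_of_comp_eq_counit`). As a left adjoint, `L
D` is small: it is generated as a comodule by the image of the unit `D → U (L D)`
(`dualSpan_unit_eq_top`), and each element of a comodule generates a finite dimensional subcomodule.
Hence `L D` is finite dimensional if `D` is, and otherwise its dimension is at most `ℵ₀ · dim D =
dim D`. -/

namespace FrobeniusExtension

namespace RightComod

/-! ### Subcomodules generated by a set, and their local finiteness. -/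

section Subcomodule

variable {K : Type u} [Field K]
variable {C : Type v} [AddCommGroup C] [Module K C] [Coalgebra K C]

/-- The evaluation `M ⊗ C → M` of the second factor at a functional. -/
noncomputable def evalRight {C : Type*} [AddCommGroup C] [Module K C] (M : Type*)
    [AddCommGroup M] [Module K M] (f : C →ₗ[K] K) : M ⊗[K] C →ₗ[K] M :=
  (TensorProduct.rid K M).toLinearMap ∘ₗ f.lTensor M

@[simp]
theorem evalRight_tmul {C : Type*} [AddCommGroup C] [Module K C] {M : Type*} [AddCommGroup M]
    [Module K M] (f : C →ₗ[K] K) (m : M) (c : C) :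
    evalRight M f (m ⊗ₜ[K] c) = f c • m := by
  simp [evalRight]

theorem evalRight_rTensor {C : Type*} [AddCommGroup C] [Module K C] {M N : Type*}
    [AddCommGroup M] [Module K M] [AddCommGroup N] [Module K N] (f : C →ₗ[K] K) (g : M →ₗ[K] N)
    (x : M ⊗[K] C) : evalRight N f (g.rTensor C x) = g (evalRight M f x) := by
  induction x with
  | zero => simp
  | tmul m c => simp
  | add x y hx hy => simp [hx, hy]

/-- The coordinate functionals of a basis of `C` already separate tensors. -/
theorem eq_zero_of_evalRight_eq_zero {C : Type*} [AddCommGroup C] [Module K C] {M : Type*}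
    [AddCommGroup M] [Module K M] (x : M ⊗[K] C) (h : ∀ f, evalRight M f x = 0) : x = 0 := by
  let b := Module.Free.chooseBasis K C
  apply (TensorProduct.equivFinsuppOfBasisRight (M := M) b).injective
  rw [map_zero]
  ext i
  rw [Finsupp.zero_apply, ← h (b.coord i)]
  clear h
  induction x with
  | zero => simp
  | tmul m c => simp
  | add x y hx hy => simp [hx, hy]

theorem mem_range_rTensor_subtype {C : Type*} [AddCommGroup C] [Module K C] {M : Type*}
    [AddCommGroup M] [Module K M] (V : Submodule K M) (x : M ⊗[K] C)
    (h : ∀ f, evalRight M f x ∈ V) : x ∈ LinearMap.range (V.subtype.rTensor C) := by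
  have hex : Function.Exact (V.subtype.rTensor C) (V.mkQ.rTensor C) :=
    rTensor_exact C (LinearMap.exact_subtype_mkQ V) V.mkQ_surjective
  refine (hex x).1 (eq_zero_of_evalRight_eq_zero _ fun f => ?_)
  rw [evalRight_rTensor]
  simpa using h f

theorem exists_finset_evalRight_mem_span {C : Type*} [AddCommGroup C] [Module K C] {M : Type*}
    [AddCommGroup M] [Module K M] (x : M ⊗[K] C) :
    ∃ s : Finset M, ∀ f, evalRight M f x ∈ Submodule.span K (s : Set M) := by
  classical
  induction x with
  | zero => exact ⟨∅, by simp⟩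
  | tmul m c =>
    exact ⟨{m}, fun f => by
      simpa using Submodule.smul_mem _ _ (Submodule.mem_span_singleton_self m)⟩
  | add x y hx hy =>
    obtain ⟨s, hs⟩ := hx
    obtain ⟨t, ht⟩ := hy
    refine ⟨s ∪ t, fun f => ?_⟩
    rw [map_add]
    exact add_mem (Submodule.span_mono (by simp) (hs f)) (Submodule.span_mono (by simp) (ht f))

theorem rTensor_subtype_injective {M : Type*} [AddCommGroup M] [Module K M] (V : Submodule K M)
    (E : Type*) [AddCommGroup E] [Module K E] :
    Function.Injective (V.subtype.rTensor E) :=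
  Module.Flat.rTensor_preserves_injective_linearMap _ V.injective_subtype

theorem rTensor_lTensor_apply {M N A B : Type*} [AddCommGroup M] [Module K M] [AddCommGroup N]
    [Module K N] [AddCommGroup A] [Module K A] [AddCommGroup B] [Module K B] (f : M →ₗ[K] N)
    (g : A →ₗ[K] B) (x : M ⊗[K] A) :
    f.rTensor B (g.lTensor M x) = g.lTensor N (f.rTensor A x) :=
  LinearMap.congr_fun
    ((LinearMap.rTensor_comp_lTensor (f := f) (g := g)).trans
      (LinearMap.lTensor_comp_rTensor (f := f) (g := g)).symm) x

theorem evalRight_counit_coact (M : RightComod K C) (m : M.carrier) :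
    evalRight M.carrier Coalgebra.counit (M.coact m) = m :=
  LinearMap.congr_fun M.counit_coact m

/-- Coassociativity turns two successive actions of `C^*` into one action of a convolution product;
hence `dualSpan` is stable under `C^*`. -/
theorem evalRight_coact_evalRight_coact (M : RightComod K C) (f g : C →ₗ[K] K) (m : M.carrier) :
    evalRight M.carrier g (M.coact (evalRight M.carrier f (M.coact m))) =
      evalRight M.carrier (LinearMap.mul' K K ∘ₗ TensorProduct.map g f ∘ₗ Coalgebra.comul)
        (M.coact m) := by
  have hl : ∀ x : M.carrier ⊗[K] C, evalRight M.carrier g (M.coact (evalRight M.carrier f x)) =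
      evalRight M.carrier (LinearMap.mul' K K ∘ₗ TensorProduct.map g f)
        (TensorProduct.assoc K M.carrier C C (M.coact.rTensor C x)) := by
    intro x
    induction x with
    | zero => simp
    | tmul n c =>
      simp only [evalRight_tmul, map_smul, LinearMap.rTensor_tmul]
      induction M.coact n with
      | zero => simp
      | tmul p d => simp [smul_smul, mul_comm]
      | add y z hy hz => simp only [map_add, smul_add, TensorProduct.add_tmul, hy, hz]
    | add y z hy hz => simp only [map_add, hy, hz]
  rw [hl]
  have h := LinearMap.congr_fun M.coassoc m
  simp only [LinearMap.comp_apply, LinearEquiv.coe_coe] at h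
  rw [h]
  simp only [evalRight, LinearMap.comp_apply, LinearMap.lTensor_comp]

/-- The subcomodule on a subspace stable under the coaction. -/
noncomputable def subcomodule (M : RightComod K C) (V : Submodule K M.carrier)
    (ρ : V →ₗ[K] V ⊗[K] C) (hρ : V.subtype.rTensor C ∘ₗ ρ = M.coact ∘ₗ V.subtype) :
    RightComod K C where
  carrier := V
  coact := ρ
  coassoc := by
    ext v
    apply rTensor_subtype_injective V (C ⊗[K] C)
    have hv : V.subtype.rTensor C (ρ v) = M.coact v := LinearMap.congr_fun hρ v
    have h1 : ∀ x : V ⊗[K] C, V.subtype.rTensor (C ⊗[K] C)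
        (TensorProduct.assoc K V C C (ρ.rTensor C x)) =
        TensorProduct.assoc K M.carrier C C
          (M.coact.rTensor C (V.subtype.rTensor C x)) := by
      intro x
      induction x with
      | zero => simp
      | tmul w c =>
        have hw : V.subtype.rTensor C (ρ w) = M.coact w := LinearMap.congr_fun hρ w
        simp only [LinearMap.rTensor_tmul, Submodule.subtype_apply, ← hw]
        induction ρ w with
        | zero => simp
        | tmul p d => simp
        | add y z hy hz => simp only [map_add, TensorProduct.add_tmul, hy, hz]
      | add y z hy hz => simp only [map_add, hy, hz]
    simp only [LinearMap.comp_apply, LinearEquiv.coe_coe]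
    rw [h1, rTensor_lTensor_apply, hv]
    exact LinearMap.congr_fun M.coassoc v
  counit_coact := by
    ext v
    have hv : V.subtype.rTensor C (ρ v) = M.coact v := LinearMap.congr_fun hρ v
    change ((evalRight V Coalgebra.counit (ρ v) : V) : M.carrier) = v
    rw [← V.subtype_apply, ← evalRight_rTensor, hv, evalRight_counit_coact]

/-- The subspace `C^* · T` of a comodule. -/
def dualSpan (M : RightComod K C) (T : Set M.carrier) : Submodule K M.carrier :=
  Submodule.span K {x | ∃ t ∈ T, ∃ f, x = evalRight M.carrier f (M.coact t)}

theorem subset_dualSpan (M : RightComod K C) (T : Set M.carrier) :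
    T ⊆ (M.dualSpan T : Set M.carrier) := fun t ht =>
  Submodule.subset_span ⟨t, ht, Coalgebra.counit, (evalRight_counit_coact M t).symm⟩

/-- Stability under `C^*` forces the coaction into the image of `V ⊗ C`, and flatness over `K` makes
the lift to `V ⊗ C` unique, hence linear. -/
theorem exists_coact_dualSpan (M : RightComod K C) (T : Set M.carrier) :
    ∃ ρ : M.dualSpan T →ₗ[K] M.dualSpan T ⊗[K] C,
      (M.dualSpan T).subtype.rTensor C ∘ₗ ρ = M.coact ∘ₗ (M.dualSpan T).subtype := by
  let V := M.dualSpan T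
  have hle : ∀ v : V, (M.coact ∘ₗ V.subtype) v ∈ LinearMap.range (V.subtype.rTensor C) := by
    rintro ⟨v, hv⟩
    change M.coact v ∈ _
    have : V ≤ (LinearMap.range (V.subtype.rTensor C)).comap M.coact := by
      refine Submodule.span_le.2 ?_
      rintro _ ⟨t, ht, f, rfl⟩
      refine mem_range_rTensor_subtype V _ fun g => ?_
      rw [evalRight_coact_evalRight_coact]
      exact Submodule.subset_span ⟨t, ht, _, rfl⟩
    exact this hv
  let e := LinearEquiv.ofInjective _ (rTensor_subtype_injective V C)
  refine ⟨e.symm.toLinearMap ∘ₗ (M.coact ∘ₗ V.subtype).codRestrict _ hle, ?_⟩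
  ext v
  exact congrArg Subtype.val (e.apply_symm_apply ((M.coact ∘ₗ V.subtype).codRestrict _ hle v))

/-- Each `M.coact (t i)` is a finite sum of pure tensors, whose left factors span all its
evaluations. One finite set per index is what the cardinal count needs. -/
theorem exists_finset_dualSpan_range_le (M : RightComod K C) {ι : Type*} (t : ι → M.carrier) :
    ∃ s : ι → Finset M.carrier,
      M.dualSpan (Set.range t) ≤ Submodule.span K (⋃ i, (s i : Set M.carrier)) := by
  choose s hs using fun i => exists_finset_evalRight_mem_span (M.coact (t i))
  refine ⟨s, Submodule.span_le.2 ?_⟩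
  rintro _ ⟨_, ⟨i, rfl⟩, f, rfl⟩
  exact Submodule.span_mono (Set.subset_iUnion (fun i => (s i : Set M.carrier)) i) (hs i f)

end Subcomodule

/-! ### Size bounds on the values of the two adjoints. -/

section Adjunction

variable {K : Type u} [Field K]
variable {C : Type v} [AddCommGroup C] [Module K C] [Coalgebra K C]
variable {D : Type v} [AddCommGroup D] [Module K D] [Coalgebra K D]

variable (K C) in
/-- The coalgebra `C` as a right comodule over itself. -/
def regular : RightComod K C where
  carrier := C
  coact := Coalgebra.comul
  coassoc := Coalgebra.coassoc
  counit_coact := by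
    ext c
    simp

/-- A coalgebra morphism `C → D` as a morphism of `D`-comodules. -/
def regularHom (l : C →ₗc[K] D) : (corestrict l).obj (regular K C) ⟶ regular K D :=
  Hom.mk l.toLinearMap <| by
    change Coalgebra.comul ∘ₗ l.toLinearMap =
      l.toLinearMap.rTensor D ∘ₗ l.toLinearMap.lTensor C ∘ₗ Coalgebra.comul
    rw [← l.map_comp_comul, ← LinearMap.comp_assoc, LinearMap.rTensor_comp_lTensor]

/-- A comodule map out of `C` through which the counit of `C` factors is injective. -/
theorem injective_of_comp_eq_counit {M : RightComod K C} (g : regular K C ⟶ M)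
    (φ : M.carrier →ₗ[K] K) (h : φ ∘ₗ Hom.toLinearMap g = Coalgebra.counit (R := K) (A := C)) :
    Function.Injective (Hom.toLinearMap g) := by
  let g' : C →ₗ[K] M.carrier := Hom.toLinearMap g
  change φ ∘ₗ g' = _ at h
  change Function.Injective g'
  -- Colinearity of `g` reduces this left inverse to `(ε ⊗ id) ∘ Δ = id`; `φ` need only be linear.
  have key : ∀ c : C, TensorProduct.lid K C (φ.rTensor C (M.coact (g' c))) = c := by
    intro c
    have hg : M.coact (g' c) = g'.rTensor C (Coalgebra.comul (R := K) c) :=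
      LinearMap.congr_fun (Hom.comm g) c
    rw [hg, ← LinearMap.comp_apply (φ.rTensor C), ← LinearMap.rTensor_comp, h]
    simp
  exact Function.LeftInverse.injective (g := fun x => TensorProduct.lid K C (φ.rTensor C (M.coact x))) key

theorem rank_le_rank_rightAdjoint_obj_regular (l : C →ₗc[K] D) {R : RightComod K D ⥤ RightComod K C}
    (adj : corestrict l ⊣ R) :
    Module.rank K C ≤ Module.rank K (R.obj (regular K D)).carrier := by
  let g : regular K C ⟶ R.obj (regular K D) := adj.homEquiv _ _ (regularHom l)
  have hg : (corestrict l).map g ≫ adj.counit.app (regular K D) = regularHom l := by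
    exact (adj.homEquiv_counit _ _ g).symm.trans (Equiv.symm_apply_apply _ _)
  refine LinearMap.rank_le_of_injective _ (injective_of_comp_eq_counit g
    (Coalgebra.counit (R := K) (A := D) ∘ₗ
      Hom.toLinearMap (adj.counit.app (regular K D))) ?_)
  have h : Hom.toLinearMap (adj.counit.app (regular K D)) ∘ₗ (Hom.toLinearMap g : C →ₗ[K] _) =
      l.toLinearMap :=
    congrArg Hom.toLinearMap hg
  exact (congrArg (fun f => Coalgebra.counit (R := K) (A := D) ∘ₗ f) h).trans l.counit_comp

/-- The value of a left adjoint of corestriction is generated by the image of the unit. -/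
theorem dualSpan_unit_eq_top (l : C →ₗc[K] D) {L : RightComod K D ⥤ RightComod K C}
    (adj : L ⊣ corestrict l) (N : RightComod K D) (T : Set (L.obj N).carrier)
    (hT : LinearMap.range (Hom.toLinearMap (adj.unit.app N)) ≤ Submodule.span K T) :
    (L.obj N).dualSpan T = ⊤ := by
  obtain ⟨ρ, hρ⟩ := exists_coact_dualSpan (L.obj N) T
  let V := (L.obj N).dualSpan T
  let η : N.carrier →ₗ[K] (L.obj N).carrier := Hom.toLinearMap (adj.unit.app N)
  have hη : ∀ n, η n ∈ V := fun n =>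
    Submodule.span_le.2 (subset_dualSpan (L.obj N) T) (hT ⟨n, rfl⟩)
  let W := subcomodule (L.obj N) V ρ hρ
  let j : W ⟶ L.obj N := Hom.mk V.subtype hρ.symm
  let e : N ⟶ (corestrict l).obj W := Hom.mk (η.codRestrict V hη) <| by
    ext n
    apply rTensor_subtype_injective V D
    change V.subtype.rTensor D (l.toLinearMap.lTensor V (ρ (η.codRestrict V hη n))) =
      V.subtype.rTensor D ((η.codRestrict V hη).rTensor D (N.coact n))
    have h2 : V.subtype.rTensor C (ρ (η.codRestrict V hη n)) = (L.obj N).coact (η n) :=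
      LinearMap.congr_fun hρ _
    rw [rTensor_lTensor_apply, h2, ← LinearMap.rTensor_comp_apply,
      LinearMap.subtype_comp_codRestrict]
    exact LinearMap.congr_fun (Hom.comm (adj.unit.app N)) n
  have hej : e ≫ (corestrict l).map j = adj.unit.app N := rfl
  -- The unit factors through the subcomodule `W`, so by adjunction the inclusion `j` has a section
  -- and `W` is everything.
  have hid : (adj.homEquiv N W).symm e ≫ j = 𝟙 (L.obj N) := by
    apply (adj.homEquiv N (L.obj N)).injective
    rw [Adjunction.homEquiv_naturality_right, Equiv.apply_symm_apply, hej, adj.homEquiv_id]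
  rw [eq_top_iff]
  intro x _
  have hx : V.subtype (Hom.toLinearMap ((adj.homEquiv N W).symm e) x) = x :=
    LinearMap.congr_fun (congrArg Hom.toLinearMap hid) x
  rw [← hx]
  exact Subtype.prop _

theorem exists_finset_span_leftAdjoint_obj (l : C →ₗc[K] D) {L : RightComod K D ⥤ RightComod K C}
    (adj : L ⊣ corestrict l) (N : RightComod K D) {ι : Type*} (b : Module.Basis ι K N.carrier) :
    ∃ s : ι → Finset (L.obj N).carrier,
      Submodule.span K (⋃ i, (s i : Set (L.obj N).carrier)) = ⊤ := by
  let η : N.carrier →ₗ[K] (L.obj N).carrier := Hom.toLinearMap (adj.unit.app N)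
  obtain ⟨s, hs⟩ := exists_finset_dualSpan_range_le (L.obj N) (η ∘ b)
  refine ⟨s, top_le_iff.1 (le_trans (dualSpan_unit_eq_top l adj N _ ?_).ge hs)⟩
  change LinearMap.range η ≤ _
  rw [LinearMap.range_eq_map, ← b.span_eq, Submodule.map_span, Set.range_comp]

/-- A left adjoint of corestriction preserves finite dimensionality. -/
theorem finite_leftAdjoint_obj (l : C →ₗc[K] D) {L : RightComod K D ⥤ RightComod K C}
    (adj : L ⊣ corestrict l) (N : RightComod K D) [Module.Finite K N.carrier] :
    Module.Finite K (L.obj N).carrier := by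
  obtain ⟨s, hs⟩ := exists_finset_span_leftAdjoint_obj l adj N
    (Module.Free.chooseBasis K N.carrier)
  exact ⟨Submodule.fg_def.2 ⟨_, Set.finite_iUnion fun i => (s i).finite_toSet, hs⟩⟩

theorem rank_leftAdjoint_obj_le (l : C →ₗc[K] D) {L : RightComod K D ⥤ RightComod K C}
    (adj : L ⊣ corestrict l) (N : RightComod K D) (hN : ¬ Module.Finite K N.carrier) :
    Module.rank K (L.obj N).carrier ≤ Module.rank K N.carrier := by
  obtain ⟨s, hs⟩ := exists_finset_span_leftAdjoint_obj l adj N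
    (Module.Free.chooseBasis K N.carrier)
  have hr : Cardinal.aleph0 ≤ Module.rank K N.carrier := by
    rwa [← not_lt, Module.rank_lt_aleph0_iff]
  calc Module.rank K (L.obj N).carrier
      = Module.rank K (Submodule.span K (⋃ i, (s i : Set (L.obj N).carrier))) := by
        rw [hs, rank_top]
    _ ≤ Cardinal.mk (⋃ i, (s i : Set (L.obj N).carrier)) := rank_span_le _
    _ ≤ Cardinal.sum fun i => Cardinal.mk (s i : Set (L.obj N).carrier) :=
        Cardinal.mk_iUnion_le_sum_mk
    _ ≤ Cardinal.sum fun _ : Module.Free.ChooseBasisIndex K N.carrier => Cardinal.aleph0 :=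
        Cardinal.sum_le_sum _ _ fun i => (Cardinal.lt_aleph0_of_finite _).le
    _ = Module.rank K N.carrier := by
        rw [Cardinal.sum_const', ← Module.Free.rank_eq_card_chooseBasisIndex,
          Cardinal.mul_aleph0_eq hr]

end Adjunction

end RightComod

end FrobeniusExtension

open FrobeniusExtension RightComod in
theorem theorem3p3 {K : Type u} [Field K]
    {C : Type v} [AddCommGroup C] [Module K C] [Coalgebra K C]
    {D : Type v} [AddCommGroup D] [Module K D] [Coalgebra K D]
    (l : C →ₗc[K] D) (hl : FrobeniusExtension.IsFrobeniusExtension l) :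
    Module.rank K C ≤ Module.rank K D ∨ (Module.Finite K C ∧ Module.Finite K D) := by
  obtain ⟨L, R, ⟨adjL⟩, ⟨adjR⟩, ⟨i⟩⟩ := hl
  -- The isomorphism makes `L` itself a right adjoint, so both bounds concern the same comodule.
  have hC := rank_le_rank_rightAdjoint_obj_regular l (adjR.ofNatIsoRight i.symm)
  by_cases hD : Module.Finite K D
  · have : Module.Finite K (regular K D).carrier := hD
    have := finite_leftAdjoint_obj l adjL (regular K D)
    exact Or.inr ⟨Module.rank_lt_aleph0_iff.1 (hC.trans_lt (Module.rank_lt_aleph0 K _)), hD⟩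
  · exact Or.inl (hC.trans (rank_leftAdjoint_obj_le l adjL (regular K D) hD))
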